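/- Let $m\ge 2$ terminals be given, and let $Y_{i,j}$ ($1\le i\ne j\le m$) be jointly distributed random variables with finite alphabets such that the network is pair-wise independent, i.e. for all $i\neq j$ $$I\bigl(Y_{i,j},Y_{j,i};\{Y_{k,l}: k\ne l,\ (k,l)\neq (i,j),(j,i)\}\bigr)=0 .$$ Terminal $i$ observes $n$ independent repetitions $X_i^n$ of $X_i=(Y_{i,j})_{j\ne i}$; all entropies use one fixed logarithm base. The terminals may privately randomize, with finite-valued random variables $U_1,\dots,U_m$ that are mutually independent and independent of the observations, and may communicate over a noiseless public channel, interactively in finitely many time slots: the message sent in a slot (from a finite alphabet) is a function of $U_i$, $X_i^n$ and all earlier messages, where $i$ is the terminal assigned to that slot. Let $F$ denote all the messages together. For $A\subseteq\{1,\dots,m\}$ and $\varepsilon>0$, a function $K$ of $(U_1,\dots,U_m,X_1^n,\dots,X_m^n)$ with values in a finite set $\mathcal K$ is an $\varepsilon$-secret key for $A$ if (i) for each $i\in A$ there is a function $g_i$ with $\Pr[g_i(U_i,X_i^n,F)\ne K]\le\varepsilon$, (ii) $\frac1n I(K;F)\le\varepsilon$, and (iii) $\frac1n H(K)\ge\frac1n\log|\mathcal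 K|-\varepsilon$. A rate $R$ is achievable if for every $\varepsilon>0$ and all sufficiently large $n$ there is, with suitable randomization and communication, an $\varepsilon$-secret key $K$ for $A$ with $\frac1nH(K)\ge R-\varepsilon$. The secret key capacity $C_{SK}(A)$ is the supremum of the achievable rates. For $k\ge 2$ let $\mathcal B_k(A)$ be the set of all partitions $(B_1,\dots,B_k)$ of $\{1,\dots,m\}$ into $k$ blocks each of which intersects $A$. Then, for every $A$ with $|A|\ge 2$, $$C_{SK}(A)\le \min_{2\le k\le |A|}\frac{1}{k-1}I'_k(A),\qquad I'_k(A)=\min_{(B_1,\dots,B_k)\in\mathcal B_k(A)}\ \sum_{l<r}\ \sum_{i\in B_l,\ j\in B_r} I(Y_{i,j};Y_{j,i}).$$ -/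

import Mathlib

open MeasureTheory

noncomputable section

namespace SecretKey

/-- Shannon entropy (in nats) of a random variable `X` with finite alphabet `S`. -/
def entropy {Ω S : Type*} [MeasurableSpace Ω] [Fintype S] (μ : Measure Ω) (X : Ω → S) : ℝ :=
  ∑ x : S, Real.negMulLog (μ.real (X ⁻¹' {x}))

/-- Mutual information `I(X;Y) = H(X) + H(Y) - H(X,Y)` of finite-valued random variables. -/
def mutualInfo {Ω S T : Type*} [MeasurableSpace Ω] [Fintype S] [Fintype T]
    (μ : Measure Ω) (X : Ω → S) (Y : Ω → T) : ℝ :=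
  entropy μ X + entropy μ Y - entropy μ (fun ω => (X ω, Y ω))

section Model

variable {m : ℕ} {𝒳 : Fin m → Type*}

/-- What happens in `n` repetitions of the source: the `n` source symbols `(X_1,...,X_m)`,
and the private randomness of each terminal (terminal `i` draws from `Fin (u i)`). -/
abbrev Outcome (𝒳 : Fin m → Type*) (n : ℕ) (u : Fin m → ℕ) : Type _ :=
  (Fin n → ∀ i, 𝒳 i) × (∀ i, Fin (u i))

/-- The law of the outcome: the source symbols are i.i.d. with joint law `P`, and the private
random variables have laws `ν i`, are mutually independent and independent of the source. -/
def outcomeLaw [∀ i, MeasurableSpace (𝒳 i)] (P : Measure (∀ i, 𝒳 i)) (n : ℕ)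
    {u : Fin m → ℕ} (ν : ∀ i, Measure (Fin (u i))) : Measure (Outcome 𝒳 n u) :=
  (Measure.pi fun _ : Fin n => P).prod (Measure.pi ν)

/-- The private data of terminal `i`: its randomness and its observations `X_i^n`. -/
def localView {n : ℕ} {u : Fin m → ℕ} (i : Fin m) (s : Outcome 𝒳 n u) :
    Fin (u i) × (Fin n → 𝒳 i) :=
  (s.2 i, fun t => s.1 t i)

/-- Interactive public communication in `r` time slots: the message `F t` of slot `t` is
a function of the private data of the terminal `speaker t` and of all earlier messages. -/
def IsPublicCommunication {n : ℕ} {u : Fin m → ℕ} {r b : ℕ} (speaker : Fin r → Fin m)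
    (F : Fin r → Outcome 𝒳 n u → Fin b) : Prop :=
  ∀ t : Fin r, ∃ f : Fin (u (speaker t)) × (Fin n → 𝒳 (speaker t)) →
      ({q : Fin r // q < t} → Fin b) → Fin b,
    ∀ s, F t s = f (localView (speaker t) s) (fun q => F q s)

/-- `K` is an `ε`-secret key for the group `A`, obtained with the public transmissions `F`. -/
structure IsSecretKey [∀ i, MeasurableSpace (𝒳 i)] {n : ℕ} {u : Fin m → ℕ}
    (μ : Measure (Outcome 𝒳 n u)) (A : Finset (Fin m)) {r b N : ℕ}
    (F : Fin r → Outcome 𝒳 n u → Fin b) (K : Outcome 𝒳 n u → Fin N) (ε : ℝ) : Prop where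
  /-- every terminal of `A` recovers the key from its data and the public transmissions -/
  recoverable : ∀ i ∈ A, ∃ g : Fin (u i) × (Fin n → 𝒳 i) → (Fin r → Fin b) → Fin N,
    μ.real {s | g (localView i s) (fun t => F t s) ≠ K s} ≤ ε
  /-- the key is nearly independent of the public transmissions -/
  secret : mutualInfo μ K (fun s t => F t s) ≤ n * ε
  /-- the key is nearly uniform on its alphabet -/
  uniform : Real.log N - n * ε ≤ entropy μ K

/-- `R` is an achievable secret key rate for the group `A`. -/
def IsAchievable [∀ i, MeasurableSpace (𝒳 i)] (P : Measure (∀ i, 𝒳 i)) (A : Finset (Fin m))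
    (R : ℝ) : Prop :=
  ∀ ε : ℝ, 0 < ε → ∃ n₀ : ℕ, ∀ n : ℕ, n₀ ≤ n →
    ∃ (u : Fin m → ℕ) (ν : ∀ i, Measure (Fin (u i))) (r b N : ℕ) (speaker : Fin r → Fin m)
      (F : Fin r → Outcome 𝒳 n u → Fin b) (K : Outcome 𝒳 n u → Fin N),
      (∀ i, IsProbabilityMeasure (ν i)) ∧
      IsPublicCommunication speaker F ∧
      IsSecretKey (outcomeLaw P n ν) A F K ε ∧
      R - ε ≤ entropy (outcomeLaw P n ν) K / n

/-- The secret key capacity `C_SK(A)` of the source with joint law `P`: the supremum, in the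
extended reals, of the achievable secret key rates. -/
def capacity [∀ i, MeasurableSpace (𝒳 i)] (P : Measure (∀ i, 𝒳 i)) (A : Finset (Fin m)) :
    EReal :=
  ⨆ (R : ℝ) (_ : IsAchievable P A R), (R : EReal)

/-- `(B_1,...,B_k)` is a partition of the set of terminals, every block of which meets `A`. -/
structure IsKPartition (A : Finset (Fin m)) {k : ℕ} (B : Fin k → Finset (Fin m)) : Prop where
  disjoint : ∀ l r, l ≠ r → Disjoint (B l) (B r)
  cover : ∀ i, ∃ l, i ∈ B l
  meets : ∀ l, (B l ∩ A).Nonempty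

end Model

section Pairwise

variable {m : ℕ} {𝒴 : Fin m → Fin m → Type*} {Ω : Type*} [MeasurableSpace Ω]

/-- Pair-wise independence: for `i ≠ j`, the pair `(Y_{i,j}, Y_{j,i})` has zero mutual
information with the family of all `Y_{k,l}`, `k ≠ l`, `(k,l) ≠ (i,j), (j,i)`.
(The values `Y i i` never play a role.) -/
def IsPairwiseIndependent [∀ i j, Fintype (𝒴 i j)] (μ : Measure Ω)
    (Y : ∀ i j, Ω → 𝒴 i j) : Prop :=
  ∀ i j, i ≠ j →
    mutualInfo μ (fun ω => (Y i j ω, Y j i ω))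
      (fun ω (p : {p : Fin m × Fin m // p.1 ≠ p.2 ∧ p ≠ (i, j) ∧ p ≠ (j, i)}) =>
        Y p.1.1 p.1.2 ω) = 0

/-- The joint law of `(X_1,...,X_m)`, where `X_i = (Y_{i,j})_{j ≠ i}`. -/
def networkLaw [∀ i j, MeasurableSpace (𝒴 i j)] (μ : Measure Ω) (Y : ∀ i j, Ω → 𝒴 i j) :
    Measure (∀ i, ∀ j : {j : Fin m // j ≠ i}, 𝒴 i j) :=
  μ.map fun ω i j => Y i j ω

/-- The sum of `I(Y_{i,j};Y_{j,i})` over `i ∈ B_l`, `j ∈ B_r`, `l < r`. -/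
def crossInfo [∀ i j, Fintype (𝒴 i j)] (μ : Measure Ω) (Y : ∀ i j, Ω → 𝒴 i j)
    {k : ℕ} (B : Fin k → Finset (Fin m)) : ℝ :=
  ∑ l : Fin k, ∑ r : Fin k with l < r, ∑ i ∈ B l, ∑ j ∈ B r, mutualInfo μ (Y i j) (Y j i)

/-- `I'_k(A)`: the minimum of `crossInfo` over the `k`-partitions whose blocks all meet `A`
(a finite set of partitions, nonempty if `1 ≤ k ≤ |A|`). -/
def minCrossInfo [∀ i j, Fintype (𝒴 i j)] (μ : Measure Ω) (Y : ∀ i j, Ω → 𝒴 i j)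
    (A : Finset (Fin m)) (k : ℕ) : ℝ :=
  sInf {v : ℝ | ∃ B : Fin k → Finset (Fin m), IsKPartition A B ∧ v = crossInfo μ Y B}

/-- The minimum of `I'_k(A) / (k - 1)` over `2 ≤ k ≤ |A|` (a nonempty range if `2 ≤ |A|`). -/
def partitionBound [∀ i j, Fintype (𝒴 i j)] (μ : Measure Ω) (Y : ∀ i j, Ω → 𝒴 i j)
    (A : Finset (Fin m)) : ℝ :=
  sInf {v : ℝ | ∃ k : ℕ, 2 ≤ k ∧ k ≤ A.card ∧ v = minCrossInfo μ Y A k / ((k : ℝ) - 1)}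

end Pairwise

end SecretKey

end

/-! Fix a partition into k blocks, each meeting A, and let V_l be all the private data of block l.
The quantity carried through the proof is D(G) = ∑ H(V_l | G) - H(V | G), which is nonnegative by
conditional subadditivity.

A message computed from one V_l and the past lowers H(V_l | G) and H(V | G) by the same amount and
raises no other H(V_j | G), so communication never increases D (`condMultiInfo_communication_le`).
Since each block contains a terminal that nearly recovers K, conditioning on K as well lowers D(F)
by (k - 1) H(K | F), up to Fano errors; nonnegativity of D(K, F) then bounds (k - 1) H(K | F) by
D(F) and hence by the initial D (`cond_entropy_key_le`).

Initially the private randomness cancels and the source contributes at most n times its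
single-letter multi-information (`multiInfo_outcomeLaw_le`). Letting ε tend to 0 gives
`IsAchievable.mul_le`. In a pair-wise independent network the multi-information splits over pairs of
terminals: a pair inside a block contributes nothing, a separated pair at most I(Y_{i,j}; Y_{j,i})
(`multiInfo_network_le`). -/

noncomputable section

namespace SecretKey

/-! ### Shannon inequalities on a finite sample space -/

section Entropy

theorem real_fiber_pos {Ω S : Type*} [MeasurableSpace Ω] (μ : Measure Ω) [IsFiniteMeasure μ]
    (X : Ω → S) {ω : Ω} (h : 0 < μ.real {ω}) : 0 < μ.real (X ⁻¹' {X ω}) :=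
  h.trans_le (measureReal_mono (by simp))

theorem entropy_unit {Ω : Type*} [MeasurableSpace Ω] (μ : Measure Ω) [IsProbabilityMeasure μ] :
    entropy μ (fun _ : Ω => ()) = 0 := by
  simp [entropy]

variable {Ω S T R : Type*} [Fintype Ω] [MeasurableSpace Ω] [DiscreteMeasurableSpace Ω]
  [Fintype S] [Fintype T] [Fintype R] (μ : Measure Ω) [IsProbabilityMeasure μ]


/-- Integrating a function of `X` against `μ` is summing it against the law of `X`. -/
theorem sum_singleton_mul_comp (X : Ω → S) (h : S → ℝ) :
    ∑ ω, μ.real {ω} * h (X ω) = ∑ x, μ.real (X ⁻¹' {x}) * h x := by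
  classical
  rw [← Finset.sum_fiberwise (s := Finset.univ) (g := X)]
  refine Finset.sum_congr rfl fun x _ => ?_
  have : X ⁻¹' {x} = ((Finset.univ.filter fun ω => X ω = x : Finset Ω) : Set Ω) := by
    ext; simp
  rw [this, ← sum_measureReal_singleton, Finset.sum_mul]
  refine Finset.sum_congr rfl fun ω hω => ?_
  rw [(Finset.mem_filter.1 hω).2]

theorem sum_real_preimage_singleton (X : Ω → S) : ∑ x, μ.real (X ⁻¹' {x}) = 1 := by
  have h := sum_singleton_mul_comp μ X fun _ => 1
  have h' := sum_singleton_mul_comp μ (fun _ : Ω => ()) fun _ => 1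
  simp only [mul_one] at h h'
  rw [← h, h']
  simp

/-- Entropy is the expected surprisal. -/
theorem entropy_eq_sum (X : Ω → S) :
    entropy μ X = ∑ ω, μ.real {ω} * -Real.log (μ.real (X ⁻¹' {X ω})) := by
  rw [sum_singleton_mul_comp μ X fun x => -Real.log (μ.real (X ⁻¹' {x}))]
  simp [entropy, Real.negMulLog]

/-- A random variable that is determined by `Y` has at most the entropy of `Y`. -/
theorem entropy_le_of_determines {X : Ω → S} {Y : Ω → T}
    (h : ∀ ω ω', Y ω = Y ω' → X ω = X ω') : entropy μ X ≤ entropy μ Y := by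
  rw [entropy_eq_sum, entropy_eq_sum]
  refine Finset.sum_le_sum fun ω _ => ?_
  rcases (measureReal_nonneg (μ := μ) (s := {ω})).eq_or_lt with h0 | h0
  · simp [← h0]
  · refine mul_le_mul_of_nonneg_left (neg_le_neg ?_) h0.le
    exact Real.log_le_log (real_fiber_pos μ Y h0) (measureReal_mono fun ω' hω' => h _ _ hω')

theorem entropy_eq_of_determines {X : Ω → S} {Y : Ω → T}
    (h : ∀ ω ω', Y ω = Y ω' → X ω = X ω') (h' : ∀ ω ω', X ω = X ω' → Y ω = Y ω') :
    entropy μ X = entropy μ Y :=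
  (entropy_le_of_determines μ h).antisymm (entropy_le_of_determines μ h')

/-- Gibbs' inequality: the conditional entropy of `X` given `W` is at most the cross entropy
with respect to any conditional (sub-)probability distribution `q`. -/
theorem entropy_prod_sub_le (X : Ω → S) (W : Ω → T) (q : S → T → ℝ) (hq : ∀ x w, 0 ≤ q x w)
    (hq1 : ∀ w, ∑ x, q x w ≤ 1) (hpos : ∀ ω, 0 < μ.real {ω} → 0 < q (X ω) (W ω)) :
    entropy μ (fun ω => (X ω, W ω)) - entropy μ W ≤
      ∑ ω, μ.real {ω} * -Real.log (q (X ω) (W ω)) := by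
  set XW : Ω → S × T := fun ω => (X ω, W ω) with hXW
  set h : S × T → ℝ := fun z => μ.real (W ⁻¹' {z.2}) * q z.1 z.2 / μ.real (XW ⁻¹' {z}) with hh
  -- This is log t ≤ t - 1 at t = `h (XW ω)`; the expectation of `h` is at most 1 because `q` is a
  -- sub-probability for each `w`.
  have hterm : ∀ ω, μ.real {ω} * -Real.log (μ.real (XW ⁻¹' {XW ω})) -
      μ.real {ω} * -Real.log (μ.real (W ⁻¹' {W ω})) - μ.real {ω} * -Real.log (q (X ω) (W ω)) ≤
      μ.real {ω} * h (XW ω) - μ.real {ω} := by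
    intro ω
    rcases (measureReal_nonneg (μ := μ) (s := {ω})).eq_or_lt with h0 | h0
    · simp [← h0]
    · have h1 := real_fiber_pos μ XW h0
      have h2 := real_fiber_pos μ W h0
      have h3 := hpos ω h0
      have h4 := Real.log_le_sub_one_of_pos (div_pos (mul_pos h2 h3) h1)
      rw [Real.log_div (mul_pos h2 h3).ne' h1.ne', Real.log_mul h2.ne' h3.ne'] at h4
      have h5 := mul_le_mul_of_nonneg_left h4 h0.le
      have h6 : h (XW ω) = μ.real (W ⁻¹' {W ω}) * q (X ω) (W ω) / μ.real (XW ⁻¹' {XW ω}) := rfl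
      rw [h6]
      linarith
  have hsum := Finset.sum_le_sum fun ω (_ : ω ∈ Finset.univ) => hterm ω
  simp only [Finset.sum_sub_distrib] at hsum
  have htot : ∑ ω, μ.real {ω} = 1 := by
    simp
  have hle : ∑ ω, μ.real {ω} * h (XW ω) ≤ 1 := by
    rw [sum_singleton_mul_comp μ XW h]
    calc ∑ z, μ.real (XW ⁻¹' {z}) * h z ≤ ∑ z : S × T, μ.real (W ⁻¹' {z.2}) * q z.1 z.2 := by
          refine Finset.sum_le_sum fun z _ => ?_
          rcases (measureReal_nonneg (μ := μ) (s := XW ⁻¹' {z})).eq_or_lt with h0 | h0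
          · rw [← h0, zero_mul]
            exact mul_nonneg measureReal_nonneg (hq _ _)
          · exact (mul_div_cancel₀ _ h0.ne').le
      _ = ∑ w, μ.real (W ⁻¹' {w}) * ∑ x, q x w := by
          rw [Fintype.sum_prod_type_right]
          simp only [Finset.mul_sum]
      _ ≤ ∑ w, μ.real (W ⁻¹' {w}) := by
          refine Finset.sum_le_sum fun w _ => ?_
          exact mul_le_of_le_one_right measureReal_nonneg (hq1 w)
      _ = 1 := sum_real_preimage_singleton μ W
  rw [entropy_eq_sum μ XW, entropy_eq_sum μ W]
  linarith

/-- Conditioning on more reduces entropy: if `W` determines `Z` then `H(X|W) ≤ H(X|Z)`. -/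
theorem entropy_prod_add_le (X : Ω → S) {W : Ω → T} {Z : Ω → R}
    (h : ∀ ω ω', W ω = W ω' → Z ω = Z ω') :
    entropy μ (fun ω => (X ω, W ω)) + entropy μ Z ≤
      entropy μ (fun ω => (X ω, Z ω)) + entropy μ W := by
  set XZ : Ω → S × R := fun ω => (X ω, Z ω) with hXZ
  -- Gibbs' inequality with the conditional law of `X` given `Z` as `q`. Conditioning on `(W, Z)`
  -- lets `q` read `Z`; over null fibres of `Z` the quotient is 0, so `q` is only a sub-probability
  -- there.
  have key := entropy_prod_sub_le μ X (fun ω => (W ω, Z ω))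
    (fun x w => μ.real (XZ ⁻¹' {(x, w.2)}) / μ.real (Z ⁻¹' {w.2}))
    (fun _ _ => div_nonneg measureReal_nonneg measureReal_nonneg)
    (fun w => by
      rw [← Finset.sum_div]
      refine div_le_one_of_le₀ ?_ measureReal_nonneg
      have h1 := sum_singleton_mul_comp μ XZ (fun z => Set.indicator {w.2} 1 z.2)
      have h2 := sum_singleton_mul_comp μ Z (fun z => Set.indicator {w.2} 1 z)
      rw [h1] at h2
      classical
      simp only [Set.indicator_apply, Set.mem_singleton_iff, Pi.one_apply, mul_ite, mul_one,
        mul_zero, Finset.sum_ite_eq', Finset.mem_univ, if_true, Fintype.sum_prod_type] at h2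
      exact h2.le)
    (fun ω h0 => div_pos (real_fiber_pos μ XZ h0) (real_fiber_pos μ Z h0))
  have e1 : entropy μ (fun ω => (X ω, W ω)) = entropy μ (fun ω => (X ω, W ω, Z ω)) :=
    entropy_eq_of_determines μ (fun ω ω' e => by simp_all) fun ω ω' e => by
      simp only [Prod.mk.injEq] at e ⊢
      exact ⟨e.1, e.2, h _ _ e.2⟩
  have e2 : entropy μ W = entropy μ (fun ω => (W ω, Z ω)) :=
    entropy_eq_of_determines μ (fun ω ω' e => by simp_all) fun ω ω' e => by
      simp only [Prod.mk.injEq]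
      exact ⟨e, h _ _ e⟩
  have e3 : ∑ ω, μ.real {ω} * -Real.log (μ.real (XZ ⁻¹' {(X ω, Z ω)}) / μ.real (Z ⁻¹' {Z ω})) =
      entropy μ XZ - entropy μ Z := by
    rw [entropy_eq_sum μ XZ, entropy_eq_sum μ Z, ← Finset.sum_sub_distrib]
    refine Finset.sum_congr rfl fun ω _ => ?_
    rcases (measureReal_nonneg (μ := μ) (s := {ω})).eq_or_lt with h0 | h0
    · simp [← h0]
    · rw [Real.log_div (real_fiber_pos μ XZ h0).ne' (real_fiber_pos μ Z h0).ne']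
      ring
  rw [e1, e2]
  linarith

theorem entropy_prod_le (X : Ω → S) (W : Ω → T) :
    entropy μ (fun ω => (X ω, W ω)) ≤ entropy μ X + entropy μ W := by
  have h := entropy_prod_add_le μ X (W := W) (Z := fun _ => ()) fun _ _ _ => rfl
  rw [entropy_unit] at h
  have : entropy μ (fun ω => (X ω, ())) ≤ entropy μ X :=
    entropy_le_of_determines μ fun ω ω' e => by simp [e]
  linarith

/-- Subadditivity of the entropy conditioned on `W`. -/
theorem entropy_family_prod_sub_le {ι : Type*} {S : ι → Type*} [∀ i, Fintype (S i)]
    (X : ∀ i, Ω → S i) (W : Ω → T) (s : Finset ι) :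
    ∀ {Z : Ω → R}, (∀ ω ω', (∀ i ∈ s, X i ω = X i ω') → Z ω = Z ω') →
    entropy μ (fun ω => (Z ω, W ω)) - entropy μ W ≤
      ∑ i ∈ s, (entropy μ (fun ω => (X i ω, W ω)) - entropy μ W) := by
  classical
  intro Z hZ
  have main : entropy μ (fun ω => ((fun i : s => X i ω), W ω)) - entropy μ W ≤
      ∑ i ∈ s, (entropy μ (fun ω => (X i ω, W ω)) - entropy μ W) := by
    clear hZ
    induction s using Finset.induction_on with
    | empty =>
      simp only [Finset.sum_empty, sub_nonpos]
      refine entropy_le_of_determines μ fun ω ω' e => ?_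
      simp only [Prod.mk.injEq]
      exact ⟨funext fun i => absurd i.2 (Finset.notMem_empty _), e⟩
    | insert a s ha ih =>
      rw [Finset.sum_insert ha]
      have h := entropy_prod_add_le μ (X a) (W := fun ω => ((fun i : s => X i ω), W ω)) (Z := W)
        fun ω ω' e => by simp_all
      have h' : entropy μ (fun ω => ((fun i : (insert a s : Finset ι) => X i ω), W ω)) ≤
          entropy μ (fun ω => (X a ω, (fun i : s => X i ω), W ω)) :=
        entropy_le_of_determines μ fun ω ω' e => by
          simp only [Prod.mk.injEq, funext_iff, Subtype.forall, Finset.mem_insert] at e ⊢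
          refine ⟨fun i hi => ?_, e.2.2⟩
          rcases hi with rfl | hi
          · exact e.1
          · exact e.2.1 i hi
      linarith
  refine le_trans (sub_le_sub_right ?_ _) main
  refine entropy_le_of_determines μ fun ω ω' e => ?_
  simp only [Prod.mk.injEq, funext_iff, Subtype.forall] at e ⊢
  exact ⟨hZ _ _ e.1, e.2⟩

/-- Subadditivity of entropy. -/
theorem entropy_le_sum {ι : Type*} {S : ι → Type*} [∀ i, Fintype (S i)]
    (X : ∀ i, Ω → S i) (s : Finset ι) {Z : Ω → R}
    (hZ : ∀ ω ω', (∀ i ∈ s, X i ω = X i ω') → Z ω = Z ω') :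
    entropy μ Z ≤ ∑ i ∈ s, entropy μ (X i) := by
  have h := entropy_family_prod_sub_le μ X (fun _ => ()) s hZ
  simp only [entropy_unit, sub_zero] at h
  calc entropy μ Z ≤ _ := entropy_le_of_determines μ fun ω ω' e => by simp_all
    _ ≤ _ := h
    _ ≤ _ := Finset.sum_le_sum fun i _ =>
      entropy_le_of_determines μ fun ω ω' e => by simp [e]

/-- Fano's inequality. -/
theorem fano {N : ℕ} (K : Ω → Fin N) (W : Ω → T) (g : T → Fin N) {ε : ℝ}
    (hε : μ.real {ω | g (W ω) ≠ K ω} ≤ ε) :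
    entropy μ (fun ω => (K ω, W ω)) - entropy μ W ≤ Real.log 2 + ε * Real.log N := by
  classical
  obtain ⟨ω₀⟩ : Nonempty Ω := μ.nonempty_of_neZero
  have hN : 0 < N := Fin.pos (K ω₀)
  have hN1 : (1 : ℝ) ≤ N := by exact_mod_cast hN
  have hNpos : (0 : ℝ) < N := by linarith
  have hlogN := Real.log_nonneg hN1
  -- Half of the mass sits on the guess `g w`, half is uniform: the surprisal is at most log 2 when
  -- the guess is right and log 2 + log N always.
  set q : Fin N → T → ℝ := fun x w => (if g w = x then 2⁻¹ else 0) + (2 * N : ℝ)⁻¹ with hq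
  have hqpos : ∀ x w, 0 < q x w := fun x w => by
    simp only [hq]; split_ifs <;> positivity
  refine (entropy_prod_sub_le μ K W q (fun x w => (hqpos x w).le) (fun w => ?_)
    fun ω _ => hqpos _ _).trans ?_
  · simp only [hq, Finset.sum_add_distrib, Finset.sum_ite_eq, Finset.mem_univ, if_true,
      Finset.sum_const, Finset.card_univ, Fintype.card_fin, nsmul_eq_mul]
    field_simp
    norm_num
  · set D : Set Ω := {ω | g (W ω) ≠ K ω} with hD
    have hb : ∀ ω, -Real.log (q (K ω) (W ω)) ≤ Real.log 2 + D.indicator 1 ω * Real.log N := by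
      intro ω
      by_cases h : ω ∈ D
      · have h1 : (2 * N : ℝ)⁻¹ ≤ q (K ω) (W ω) := by
          simp only [hq]; split_ifs <;> simp
        have h2 := Real.log_le_log (by positivity) h1
        rw [Real.log_inv, Real.log_mul two_ne_zero hNpos.ne'] at h2
        simp only [Set.indicator_of_mem h, Pi.one_apply]
        linarith
      · have h' : g (W ω) = K ω := by simpa [hD] using h
        have h1 : (2 : ℝ)⁻¹ ≤ q (K ω) (W ω) := by
          simp only [hq, h', if_true, le_add_iff_nonneg_right]
          positivity
        have h2 := Real.log_le_log (by positivity) h1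
        rw [Real.log_inv] at h2
        simp only [Set.indicator_of_notMem h]
        linarith
    have htot : ∑ ω, μ.real {ω} = 1 := by
      simp
    have hDsum : ∑ ω, μ.real {ω} * D.indicator 1 ω = μ.real D := by
      have : D = ((Finset.univ.filter (· ∈ D) : Finset Ω) : Set Ω) := by ext; simp
      conv_rhs => rw [this, ← sum_measureReal_singleton, Finset.sum_filter]
      simp [Set.indicator_apply]
    calc _ ≤ ∑ ω, μ.real {ω} * (Real.log 2 + D.indicator 1 ω * Real.log N) :=
          Finset.sum_le_sum fun ω _ => mul_le_mul_of_nonneg_left (hb ω) measureReal_nonneg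
      _ = Real.log 2 + μ.real D * Real.log N := by
          simp only [mul_add, Finset.sum_add_distrib, ← Finset.sum_mul, htot, ← mul_assoc, hDsum,
            one_mul]
      _ ≤ _ := by gcongr

end Entropy

/-! ### Entropy of image measures and product measures -/

section Laws

/-- Moves entropies between sample spaces: from an arbitrary space to the finite one of the network
law, and from n repetitions to a single letter. -/
theorem entropy_comp_measurePreserving {Ω Ω' S : Type*} [MeasurableSpace Ω] [MeasurableSpace Ω']
    [DiscreteMeasurableSpace Ω'] [Fintype S] {μ : Measure Ω} {μ' : Measure Ω'} {f : Ω → Ω'}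
    (hf : MeasurePreserving f μ μ') (X : Ω' → S) :
    entropy μ (fun ω => X (f ω)) = entropy μ' X := by
  refine Finset.sum_congr rfl fun x _ => congrArg _ ?_
  exact hf.measureReal_preimage (s := X ⁻¹' {x}) MeasurableSet.of_discrete.nullMeasurableSet

theorem entropy_prod_id {S T : Type*} [Fintype S] [Fintype T] [MeasurableSpace S]
    [MeasurableSpace T] [DiscreteMeasurableSpace S] [DiscreteMeasurableSpace T]
    (μ : Measure S) (ν : Measure T) [IsProbabilityMeasure μ] [IsProbabilityMeasure ν] :
    entropy (μ.prod ν) id = entropy μ id + entropy ν id := by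
  have h1 := sum_real_preimage_singleton μ id
  have h2 := sum_real_preimage_singleton ν id
  simp only [Set.preimage_id] at h1 h2
  simp only [entropy, Set.preimage_id, Fintype.sum_prod_type, ← Set.singleton_prod_singleton,
    measureReal_prod_prod, Real.negMulLog_mul, Finset.sum_add_distrib, ← Finset.sum_mul,
    ← Finset.mul_sum, h1, h2, one_mul]

/-- The Leibniz rule for `Real.negMulLog`. Each summand is kept as a product over all of `s`, so
that summing it over a product space factorizes. -/
theorem negMulLog_prod {ι : Type*} [DecidableEq ι] (s : Finset ι) (p : ι → ℝ) :
    Real.negMulLog (∏ i ∈ s, p i) =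
      ∑ i ∈ s, ∏ j ∈ s, if j = i then Real.negMulLog (p j) else p j := by
  induction s using Finset.induction_on with
  | empty => simp
  | insert a s ha ih =>
    rw [Finset.prod_insert ha, Real.negMulLog_mul, ih, Finset.sum_insert ha,
      Finset.prod_insert ha, if_pos rfl, Finset.mul_sum, mul_comm]
    congr 1
    · congr 1
      exact Finset.prod_congr rfl fun j hj => (if_neg (ne_of_mem_of_not_mem hj ha)).symm
    · refine Finset.sum_congr rfl fun i hi => ?_
      rw [Finset.prod_insert ha, if_neg (ne_of_mem_of_not_mem hi ha).symm]

theorem entropy_pi_id {ι : Type*} [Fintype ι] [DecidableEq ι] {S : ι → Type*}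
    [∀ i, Fintype (S i)] [∀ i, MeasurableSpace (S i)] [∀ i, DiscreteMeasurableSpace (S i)]
    (μ : ∀ i, Measure (S i)) [∀ i, IsProbabilityMeasure (μ i)] :
    entropy (Measure.pi μ) id = ∑ i, entropy (μ i) id := by
  have hpi : ∀ x : ∀ i, S i, (Measure.pi μ).real {x} = ∏ i, (μ i).real {x i} := fun x => by
    simp [Measure.real, Measure.pi_singleton, ENNReal.toReal_prod]
  simp only [entropy, Set.preimage_id, hpi, negMulLog_prod]
  rw [Finset.sum_comm]
  refine Finset.sum_congr rfl fun i _ => ?_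
  have h := Finset.prod_univ_sum (fun j => (Finset.univ : Finset (S j)))
    (fun j x => if j = i then Real.negMulLog ((μ j).real {x}) else (μ j).real {x})
  rw [Fintype.piFinset_univ] at h
  -- Every factor other than the i-th is a total mass, hence 1.
  rw [← h, Finset.prod_eq_single i]
  · simp
  · intro j _ hj
    simp [hj]
  · simp

end Laws

/-! ### Multi-information under public communication -/

section Converse

variable {Ω T T' : Type*} [Fintype Ω] [MeasurableSpace Ω] [DiscreteMeasurableSpace Ω]
  [Fintype T] [Fintype T'] (μ : Measure Ω) [IsProbabilityMeasure μ]
  {k : ℕ} {S : Fin k → Type*} [∀ l, Fintype (S l)]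

/-- The conditional multi-information `∑ l, H(V_l | G) - H(V | G)`, where `V = (V_l)_l`. -/
def condMultiInfo (V : ∀ l, Ω → S l) (G : Ω → T) : ℝ :=
  ∑ l, (entropy μ (fun ω => (V l ω, G ω)) - entropy μ G) -
    (entropy μ (fun ω => ((fun l => V l ω), G ω)) - entropy μ G)

theorem condMultiInfo_nonneg (V : ∀ l, Ω → S l) (G : Ω → T) : 0 ≤ condMultiInfo μ V G :=
  sub_nonneg.2 <| entropy_family_prod_sub_le μ V G Finset.univ
    fun _ _ h => funext fun l => h l (Finset.mem_univ l)

theorem condMultiInfo_congr (V : ∀ l, Ω → S l) {G : Ω → T} {G' : Ω → T'}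
    (h : ∀ ω ω', G' ω = G' ω' → G ω = G ω') (h' : ∀ ω ω', G ω = G ω' → G' ω = G' ω') :
    condMultiInfo μ V G = condMultiInfo μ V G' := by
  have hl : ∀ l, entropy μ (fun ω => (V l ω, G ω)) = entropy μ (fun ω => (V l ω, G' ω)) :=
    fun l => entropy_eq_of_determines μ
      (fun ω ω' e => Prod.ext (Prod.mk.inj e).1 (h _ _ (Prod.mk.inj e).2))
      (fun ω ω' e => Prod.ext (Prod.mk.inj e).1 (h' _ _ (Prod.mk.inj e).2))
  have hV : entropy μ (fun ω => ((fun l => V l ω), G ω)) =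
      entropy μ (fun ω => ((fun l => V l ω), G' ω)) :=
    entropy_eq_of_determines μ
      (fun ω ω' e => Prod.ext (Prod.mk.inj e).1 (h _ _ (Prod.mk.inj e).2))
      (fun ω ω' e => Prod.ext (Prod.mk.inj e).1 (h' _ _ (Prod.mk.inj e).2))
  have hG : entropy μ G = entropy μ G' := entropy_eq_of_determines μ h h'
  simp only [condMultiInfo, hl, hV, hG]

/-- A public message that is a function of one of the `V_l` and of the earlier messages does
not increase the conditional multi-information. -/
theorem condMultiInfo_le_of_message (V : ∀ l, Ω → S l) {G : Ω → T} {G' : Ω → T'} (l₀ : Fin k)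
    (hG : ∀ ω ω', G' ω = G' ω' → G ω = G ω')
    (hG' : ∀ ω ω', V l₀ ω = V l₀ ω' → G ω = G ω' → G' ω = G' ω') :
    condMultiInfo μ V G' ≤ condMultiInfo μ V G := by
  have hV : entropy μ (fun ω => ((fun l => V l ω), G' ω)) =
      entropy μ (fun ω => ((fun l => V l ω), G ω)) :=
    entropy_eq_of_determines μ
      (fun ω ω' e => by
        simp only [Prod.mk.injEq] at e ⊢
        exact ⟨e.1, hG' _ _ (congrFun e.1 l₀) e.2⟩)
      (fun ω ω' e => by
        simp only [Prod.mk.injEq] at e ⊢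
        exact ⟨e.1, hG _ _ e.2⟩)
  have hV₀ : entropy μ (fun ω => (V l₀ ω, G' ω)) = entropy μ (fun ω => (V l₀ ω, G ω)) :=
    entropy_eq_of_determines μ
      (fun ω ω' e => by
        simp only [Prod.mk.injEq] at e ⊢
        exact ⟨e.1, hG' _ _ e.1 e.2⟩)
      (fun ω ω' e => by
        simp only [Prod.mk.injEq] at e ⊢
        exact ⟨e.1, hG _ _ e.2⟩)
  -- In the `l₀` term minus the joint term the entropy of the conditioning variable cancels, so `hV`
  -- and `hV₀` show this difference is unchanged; the other terms are conditional entropies and can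
  -- only decrease.
  unfold condMultiInfo
  rw [← Finset.add_sum_erase _ _ (Finset.mem_univ l₀), ← Finset.add_sum_erase _ _
    (Finset.mem_univ l₀), hV, hV₀]
  have : ∑ l ∈ Finset.univ.erase l₀, (entropy μ (fun ω => (V l ω, G' ω)) - entropy μ G') ≤
      ∑ l ∈ Finset.univ.erase l₀, (entropy μ (fun ω => (V l ω, G ω)) - entropy μ G) :=
    Finset.sum_le_sum fun l _ => by
      have := entropy_prod_add_le μ (V l) hG
      linarith
  linarith

/-- Interactive public communication does not increase the multi-information. -/
theorem condMultiInfo_communication_le (V : ∀ l, Ω → S l) {r b : ℕ} (F : Fin r → Ω → Fin b)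
    (hF : ∀ t, ∃ l, ∀ ω ω', V l ω = V l ω' → (∀ q, q < t → F q ω = F q ω') → F t ω = F t ω') :
    condMultiInfo μ V (fun ω t => F t ω) ≤ condMultiInfo μ V (fun _ => ()) := by
  -- Induction on the number of revealed messages; at 0 the history is trivial, at `r` it is the
  -- whole communication.
  have key : ∀ t : ℕ, t ≤ r → condMultiInfo μ V (fun ω (q : {q : Fin r // q.1 < t}) => F q ω) ≤
      condMultiInfo μ V (fun _ => ()) := by
    intro t
    induction t with
    | zero =>
      intro _
      exact (condMultiInfo_congr μ V
        (fun ω ω' _ => funext fun q => absurd q.2 (Nat.not_lt_zero _)) fun _ _ _ => rfl).le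
    | succ t ih =>
      intro ht
      refine le_trans ?_ (ih (by omega))
      obtain ⟨l, hl⟩ := hF ⟨t, ht⟩
      refine condMultiInfo_le_of_message μ V l (fun ω ω' e => ?_) (fun ω ω' eV e => ?_)
      · exact funext fun q => congrFun e ⟨q.1, q.2.trans (Nat.lt_succ_self t)⟩
      · refine funext fun q => ?_
        rcases Nat.lt_succ_iff_lt_or_eq.1 q.2 with hq | hq
        · exact congrFun e ⟨q.1, hq⟩
        · have : q.1 = ⟨t, ht⟩ := Fin.ext hq
          rw [this]
          exact hl ω ω' eV fun q' hq' => congrFun e ⟨q', hq'⟩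
  refine le_trans (le_of_eq (condMultiInfo_congr μ V (fun ω ω' e => ?_) fun ω ω' e => ?_))
    (key r le_rfl)
  · exact funext fun t => congrFun e ⟨t, t.2⟩
  · exact funext fun q => congrFun e q.1

/-- If `K` is a function of `V` and is nearly recoverable from every `(V_l, G)`, then
`(k - 1) H(K | G)` is bounded by the conditional multi-information of `V`. -/
theorem cond_entropy_key_le (V : ∀ l, Ω → S l) (G : Ω → T) {N : ℕ} (K : Ω → Fin N) {ε : ℝ}
    (hK : ∀ ω ω', (∀ l, V l ω = V l ω') → K ω = K ω')
    (hg : ∀ l, ∃ g : S l × T → Fin N, μ.real {ω | g (V l ω, G ω) ≠ K ω} ≤ ε) :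
    ((k : ℝ) - 1) * (entropy μ (fun ω => (K ω, G ω)) - entropy μ G) ≤
      condMultiInfo μ V G + k * (Real.log 2 + ε * Real.log N) := by
  -- Compared with conditioning on `G`, each of the k block terms loses H(K | G) up to a Fano error,
  -- while the joint term loses it exactly, `K` being a function of `V`. Net loss: (k - 1) H(K | G).
  have h0 := condMultiInfo_nonneg μ V fun ω => (K ω, G ω)
  have hV : entropy μ (fun ω => ((fun l => V l ω), K ω, G ω)) =
      entropy μ (fun ω => ((fun l => V l ω), G ω)) :=
    entropy_eq_of_determines μ
      (fun ω ω' e => by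
        simp only [Prod.mk.injEq] at e ⊢
        exact ⟨e.1, hK _ _ (congrFun e.1), e.2⟩)
      (fun ω ω' e => by simp_all)
  have hl : ∀ l, entropy μ (fun ω => (V l ω, K ω, G ω)) - entropy μ (fun ω => (V l ω, G ω)) ≤
      Real.log 2 + ε * Real.log N := fun l => by
    obtain ⟨g, hg⟩ := hg l
    refine le_trans (sub_le_sub_right ?_ _) (fano μ K (fun ω => (V l ω, G ω)) g hg)
    exact entropy_le_of_determines μ fun ω ω' e => by simp_all
  have hsum := Finset.sum_le_sum fun l (_ : l ∈ Finset.univ) => hl l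
  unfold condMultiInfo at h0 ⊢
  simp only [Finset.sum_sub_distrib, Finset.sum_const, Finset.card_univ, Fintype.card_fin,
    nsmul_eq_mul] at h0 hsum ⊢
  rw [hV] at h0
  linarith

theorem condMultiInfo_unit (V : ∀ l, Ω → S l) :
    condMultiInfo μ V (fun _ => ()) = ∑ l, entropy μ (V l) - entropy μ (fun ω l => V l ω) := by
  have e : ∀ {S' : Type _} [Fintype S'] (X : Ω → S'),
      entropy μ (fun ω => (X ω, ())) = entropy μ X := fun X =>
    entropy_eq_of_determines μ (fun ω ω' e => by simp_all) (fun ω ω' e => by simp_all)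
  have e' := fun l => e (V l)
  unfold condMultiInfo
  simp only [entropy_unit, sub_zero, e']
  congr 1
  exact entropy_eq_of_determines μ (fun ω ω' e => by simp_all) (fun ω ω' e => by simp_all)

end Converse

/-! ### Single-letter converse -/

section MultiInfo

variable {m : ℕ} {𝒳 : Fin m → Type*} [∀ i, Fintype (𝒳 i)] [∀ i, MeasurableSpace (𝒳 i)]
  [∀ i, DiscreteMeasurableSpace (𝒳 i)]

/-- The terminals of block `l`, blocks being the fibres of `c`. -/
abbrev Block {m k : ℕ} (c : Fin m → Fin k) (l : Fin k) : Type := {i : Fin m // c i = l}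

/-- Private randomness contributes nothing to the multi-information of the blocks, and the
`n` repetitions of the source contribute `n` times the single-letter amount. -/
theorem multiInfo_outcomeLaw_le (P : Measure (∀ i, 𝒳 i)) [IsProbabilityMeasure P] (n : ℕ)
    {u : Fin m → ℕ} (ν : ∀ i, Measure (Fin (u i))) [∀ i, IsProbabilityMeasure (ν i)] {k : ℕ}
    (c : Fin m → Fin k) :
    ∑ l, entropy (outcomeLaw P n ν) (fun s (i : Block c l) => localView (i : Fin m) s) -
        entropy (outcomeLaw P n ν) (fun s l (i : Block c l) => localView (i : Fin m) s) ≤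
      n * (∑ l, entropy P (fun x (i : Block c l) => x i) - entropy P id) := by
  have : IsProbabilityMeasure (outcomeLaw P n ν) := by unfold outcomeLaw; infer_instance
  have hX : ∀ t, MeasurePreserving (fun s : Outcome 𝒳 n u => s.1 t) (outcomeLaw P n ν) P :=
    fun t => (measurePreserving_eval (fun _ : Fin n => P) t).comp measurePreserving_fst
  have hU : ∀ i, MeasurePreserving (fun s : Outcome 𝒳 n u => s.2 i) (outcomeLaw P n ν) (ν i) :=
    fun i => (measurePreserving_eval ν i).comp measurePreserving_snd
  have hl : ∀ l, entropy (outcomeLaw P n ν) (fun s (i : Block c l) => localView (i : Fin m) s) ≤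
      n * entropy P (fun x (i : Block c l) => x i) +
        ∑ i with c i = l, entropy (ν i) id := fun l => by
    have h1 : entropy (outcomeLaw P n ν) (fun s t (i : Block c l) => s.1 t i) ≤
        ∑ t, entropy (outcomeLaw P n ν) (fun s (i : Block c l) => s.1 t i) :=
      entropy_le_sum _ (fun t (s : Outcome 𝒳 n u) (i : Block c l) => s.1 t i) Finset.univ
        fun s s' e => funext fun t => e t (Finset.mem_univ t)
    have h2 : entropy (outcomeLaw P n ν) (fun s (i : Block c l) => s.2 i) ≤
        ∑ i with c i = l, entropy (outcomeLaw P n ν) (fun s => s.2 i) :=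
      entropy_le_sum _ (fun i (s : Outcome 𝒳 n u) => s.2 i) _
        fun s s' e => funext fun i => e i.1 (by simp [i.2])
    have h3 : ∀ t, entropy (outcomeLaw P n ν) (fun s (i : Block c l) => s.1 t i) =
        entropy P (fun x (i : Block c l) => x i) := fun t =>
      entropy_comp_measurePreserving (hX t) (fun x (i : Block c l) => x i)
    have h4 : ∀ i, entropy (outcomeLaw P n ν) (fun s => s.2 i) = entropy (ν i) id := fun i =>
      entropy_comp_measurePreserving (hU i) id
    have h5 := entropy_prod_le (outcomeLaw P n ν) (fun s t (i : Block c l) => s.1 t i)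
      (fun s (i : Block c l) => s.2 i)
    have h6 : entropy (outcomeLaw P n ν) (fun s (i : Block c l) => localView (i : Fin m) s) ≤
        entropy (outcomeLaw P n ν) (fun s => ((fun t (i : Block c l) => s.1 t i),
          fun i : Block c l => s.2 i)) :=
      entropy_le_of_determines _ fun s s' e => by
        simp only [Prod.mk.injEq] at e
        exact funext fun i => Prod.ext (congrFun e.2 i)
          (funext fun t => congrFun (congrFun e.1 t) i)
    simp only [h3, h4, Finset.sum_const, Finset.card_univ, Fintype.card_fin, nsmul_eq_mul]
      at h1 h2
    linarith
  -- Block entropies need only upper bounds, from subadditivity; for the total entropy independence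
  -- is essential, and the product law gives it exactly.
  have htot : n * entropy P id + ∑ i, entropy (ν i) id ≤
      entropy (outcomeLaw P n ν) (fun s l (i : Block c l) => localView (i : Fin m) s) := by
    have h1 : entropy (outcomeLaw P n ν) id = n * entropy P id + ∑ i, entropy (ν i) id := by
      unfold outcomeLaw
      rw [entropy_prod_id, entropy_pi_id, entropy_pi_id]
      simp
    rw [← h1]
    refine entropy_le_of_determines _ fun s s' e => ?_
    have h : ∀ i, localView i s = localView i s' := fun i =>
      congrFun (congrFun e (c i)) ⟨i, rfl⟩
    exact Prod.ext (funext fun t => funext fun i => congrFun (congrArg Prod.snd (h i)) t)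
      (funext fun i => congrArg Prod.fst (h i))
  have hsum := Finset.sum_le_sum fun l (_ : l ∈ Finset.univ) => hl l
  -- The blocks partition the terminals, so the randomness terms add up to the same sum as in `htot`
  -- and cancel.
  rw [Finset.sum_add_distrib, ← Finset.mul_sum,
    Finset.sum_fiberwise Finset.univ c fun i => entropy (ν i) id] at hsum
  linarith

/-- The converse for a single block length, in terms of the single-letter multi-information. -/
theorem IsSecretKey.entropy_le (P : Measure (∀ i, 𝒳 i)) [IsProbabilityMeasure P] {n : ℕ}
    {u : Fin m → ℕ} (ν : ∀ i, Measure (Fin (u i))) [∀ i, IsProbabilityMeasure (ν i)] {k : ℕ}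
    (c : Fin m → Fin k) {A : Finset (Fin m)} (hc : ∀ l, ∃ i ∈ A, c i = l) {r b N : ℕ}
    {speaker : Fin r → Fin m} {F : Fin r → Outcome 𝒳 n u → Fin b} {K : Outcome 𝒳 n u → Fin N}
    {ε : ℝ} (hF : IsPublicCommunication speaker F)
    (hK : IsSecretKey (outcomeLaw P n ν) A F K ε) :
    ((k : ℝ) - 1) * (entropy (outcomeLaw P n ν) K - mutualInfo (outcomeLaw P n ν) K
      (fun s t => F t s)) ≤
      n * (∑ l, entropy P (fun x (i : Block c l) => x i) - entropy P id) +
        k * (Real.log 2 + ε * Real.log N) := by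
  have : IsProbabilityMeasure (outcomeLaw P n ν) := by unfold outcomeLaw; infer_instance
  have h1 := cond_entropy_key_le (outcomeLaw P n ν)
    (fun l s (i : Block c l) => localView (i : Fin m) s) (fun s t => F t s) K (ε := ε)
    (fun s s' e => by
      have h : ∀ i, localView i s = localView i s' := fun i =>
        congrFun (e (c i)) ⟨i, rfl⟩
      exact congrArg K <| Prod.ext
        (funext fun t => funext fun i => congrFun (congrArg Prod.snd (h i)) t)
        (funext fun i => congrArg Prod.fst (h i)))
    (fun l => by
      obtain ⟨i, hi, hil⟩ := hc l
      obtain ⟨g, hg⟩ := hK.recoverable i hi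
      exact ⟨fun z => g (z.1 ⟨i, hil⟩) z.2, hg⟩)
  have h2 := condMultiInfo_communication_le (outcomeLaw P n ν)
    (fun l s (i : Block c l) => localView (i : Fin m) s) F
    (fun t => by
      obtain ⟨f, hf⟩ := hF t
      refine ⟨c (speaker t), fun s s' e e' => ?_⟩
      have h : localView (speaker t) s = localView (speaker t) s' := congrFun e ⟨_, rfl⟩
      rw [hf, hf, h]
      exact congrArg _ (funext fun q => e' q.1 q.2))
  rw [condMultiInfo_unit] at h2
  have h3 := multiInfo_outcomeLaw_le P n ν c
  have h4 : entropy (outcomeLaw P n ν) K - mutualInfo (outcomeLaw P n ν) K (fun s t => F t s) =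
      entropy (outcomeLaw P n ν) (fun s => (K s, fun t => F t s)) -
        entropy (outcomeLaw P n ν) (fun s t => F t s) := by
    unfold mutualInfo; ring
  rw [h4]
  linarith

/-- An achievable rate is at most the multi-information of the blocks divided by `k - 1`. -/
theorem IsAchievable.mul_le {P : Measure (∀ i, 𝒳 i)} [IsProbabilityMeasure P]
    {A : Finset (Fin m)} {R : ℝ} (hR : IsAchievable P A R) {k : ℕ} (hk : 2 ≤ k)
    (c : Fin m → Fin k) (hc : ∀ l, ∃ i ∈ A, c i = l) :
    R * ((k : ℝ) - 1) ≤ ∑ l, entropy P (fun x (i : Block c l) => x i) - entropy P id := by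
  set J := ∑ l, entropy P (fun x (i : Block c l) => x i) - entropy P id with hJ
  have hk' : (2 : ℝ) ≤ k := by exact_mod_cast hk
  -- Near-uniformity replaces log N by h + nε, so h occurs on both sides; collecting it gives the
  -- factor k - 1 - kε, nonnegative since k ≥ 2 and ε < 1/2. Taking n > 1/ε absorbs log 2 into nε.
  have key : ∀ ε : ℝ, 0 < ε → ε < 1 / 2 →
      (R - ε) * ((k : ℝ) - 1 - k * ε) ≤ J + (k - 1) * ε + k * (ε + ε * ε) := by
    intro ε hε hε'
    obtain ⟨n₀, hn₀⟩ := hR ε hε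
    obtain ⟨n₁, hn₁⟩ := exists_nat_gt (1 / ε)
    set n := max n₀ n₁ with hn
    obtain ⟨u, ν, r, b, N, speaker, F, K, hν, hF, hK, hrate⟩ := hn₀ n (le_max_left _ _)
    have hn1 : 1 / ε < (n : ℝ) := hn₁.trans_le (by exact_mod_cast le_max_right _ _)
    have hnpos : (0 : ℝ) < n := (by positivity : 0 < 1 / ε).trans hn1
    have hlog : Real.log 2 ≤ n * ε := by
      have := (div_lt_iff₀ hε).1 hn1
      have := Real.log_two_lt_d9
      linarith
    have h1 := hK.entropy_le P ν c hc hF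
    have h2 := hK.secret
    have h3 := hK.uniform
    rw [le_div_iff₀ hnpos] at hrate
    set h := entropy (outcomeLaw P n ν) K
    have hkε : 0 ≤ (k : ℝ) - 1 - k * ε := by nlinarith
    have h4 : ((k : ℝ) - 1) * (h - n * ε) ≤ n * J + k * (n * ε + ε * (h + n * ε)) := by
      refine le_trans (mul_le_mul_of_nonneg_left (sub_le_sub_left h2 _) (by linarith)) ?_
      refine h1.trans ?_
      gcongr
      linarith
    have h5 := mul_le_mul_of_nonneg_right hrate hkε
    refine le_of_mul_le_mul_left ?_ hnpos
    linarith
  have hlim : Filter.Tendsto (fun ε : ℝ => J + (k - 1) * ε + k * (ε + ε * ε) -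
      (R - ε) * ((k : ℝ) - 1 - k * ε)) (nhdsWithin 0 (Set.Ioi 0))
      (nhds (J - R * ((k : ℝ) - 1))) := by
    have : Continuous fun ε : ℝ => J + (k - 1) * ε + k * (ε + ε * ε) -
      (R - ε) * ((k : ℝ) - 1 - k * ε) := by fun_prop
    have h := (this.tendsto 0).mono_left (nhdsWithin_le_nhds (s := Set.Ioi 0))
    simpa using h
  refine sub_nonneg.1 (ge_of_tendsto hlim ?_)
  filter_upwards [Ioo_mem_nhdsGT (show (0 : ℝ) < 1 / 2 by norm_num)] with ε hε
  exact sub_nonneg.2 (key ε hε.1 hε.2)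

end MultiInfo

/-! ### Pair-wise independent networks -/

section Network

variable {m : ℕ} {𝒴 : Fin m → Fin m → Type*} {Ω : Type*} [MeasurableSpace Ω]

theorem measurePreserving_network [∀ i j, MeasurableSpace (𝒴 i j)] (μ : Measure Ω)
    {Y : ∀ i j, Ω → 𝒴 i j} (hY : ∀ i j, Measurable (Y i j)) :
    MeasurePreserving (fun ω i (j : {j : Fin m // j ≠ i}) => Y i j ω) μ (networkLaw μ Y) :=
  ⟨measurable_pi_lambda _ fun i => measurable_pi_lambda _ fun j => hY i j, rfl⟩

theorem isProbabilityMeasure_networkLaw [∀ i j, MeasurableSpace (𝒴 i j)] (μ : Measure Ω)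
    [IsProbabilityMeasure μ] {Y : ∀ i j, Ω → 𝒴 i j} (hY : ∀ i j, Measurable (Y i j)) :
    IsProbabilityMeasure (networkLaw μ Y) :=
  Measure.isProbabilityMeasure_map (measurePreserving_network μ hY).measurable.aemeasurable

/-- A family of random variables, each independent of (a variable determining) all the others,
has an entropy at least the sum of the individual entropies. -/
theorem sum_entropy_le {ι Ω T : Type*} {S R : ι → Type*} [Fintype Ω] [MeasurableSpace Ω]
    [DiscreteMeasurableSpace Ω] [Fintype T] [∀ p, Fintype (S p)] [∀ p, Fintype (R p)]
    (μ : Measure Ω) [IsProbabilityMeasure μ] (Q : ∀ p, Ω → S p) (W : ∀ p, Ω → R p)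
    (hW : ∀ p p', p' ≠ p → ∀ ω ω', W p ω = W p ω' → Q p' ω = Q p' ω')
    (hind : ∀ p, mutualInfo μ (Q p) (W p) = 0) (s : Finset ι) {Z : Ω → T}
    (hZ : ∀ ω ω', Z ω = Z ω' → ∀ p ∈ s, Q p ω = Q p ω') :
    ∑ p ∈ s, entropy μ (Q p) ≤ entropy μ Z := by
  classical
  have main : ∑ p ∈ s, entropy μ (Q p) ≤ entropy μ (fun ω (p : s) => Q p ω) := by
    clear hZ
    induction s using Finset.induction_on with
    | empty =>
      rw [Finset.sum_empty, ← entropy_unit μ]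
      exact entropy_le_of_determines μ fun _ _ _ => rfl
    | insert a s ha ih =>
      rw [Finset.sum_insert ha]
      -- Since `W a` determines every `Q p` with `p` in `s`, H(Q_a | those) ≥ H(Q_a | W_a), and the
      -- latter is H(Q_a) by independence.
      have h1 := entropy_prod_add_le μ (Q a) (W := W a) (Z := fun ω (p : s) => Q p ω)
        fun ω ω' e => funext fun p => hW a p (ne_of_mem_of_not_mem p.2 ha) _ _ e
      have h2 := hind a
      have h3 : entropy μ (fun ω => (Q a ω, fun p : s => Q p ω)) ≤
          entropy μ (fun ω (p : (insert a s : Finset ι)) => Q p ω) :=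
        entropy_le_of_determines μ fun ω ω' e => Prod.ext
          (congrFun e ⟨a, Finset.mem_insert_self a s⟩)
          (funext fun p => congrFun e ⟨p, Finset.mem_insert_of_mem p.2⟩)
      unfold mutualInfo at h2
      linarith
  exact main.trans (entropy_le_of_determines μ fun ω ω' e => funext fun p => hZ _ _ e p p.2)

theorem mutualInfo_comm {Ω S T : Type*} [MeasurableSpace Ω] [Fintype S] [Fintype T]
    (μ : Measure Ω) (X : Ω → S) (Y : Ω → T) : mutualInfo μ X Y = mutualInfo μ Y X := by
  have : entropy μ (fun ω => (X ω, Y ω)) = entropy μ (fun ω => (Y ω, X ω)) := by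
    unfold entropy
    rw [← (Equiv.prodComm S T).sum_comp]
    refine Finset.sum_congr rfl fun z _ => congrArg _ (congrArg _ ?_)
    ext ω
    simp [Prod.ext_iff, and_comm]
  unfold mutualInfo
  rw [this]
  ring

/-- The unordered pairs of terminals. -/
abbrev Pair (m : ℕ) : Type := {p : Fin m × Fin m // p.1 < p.2}

/-- A pair of terminals separated by `c` is counted once, in the orientation that follows the order
of the blocks; symmetry of mutual information allows reorienting it by the order of the terminals.
-/
theorem crossInfo_eq [∀ i j, Fintype (𝒴 i j)] (μ : Measure Ω) (Y : ∀ i j, Ω → 𝒴 i j) {k : ℕ}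
    (c : Fin m → Fin k) :
    crossInfo μ Y (fun l => Finset.univ.filter fun i => c i = l) =
      ∑ p : Pair m, if c p.1.1 = c p.1.2 then 0
        else mutualInfo μ (Y p.1.1 p.1.2) (Y p.1.2 p.1.1) := by
  have h1 : crossInfo μ Y (fun l => Finset.univ.filter fun i => c i = l) =
      ∑ p : Fin m × Fin m, if c p.1 < c p.2 then mutualInfo μ (Y p.1 p.2) (Y p.2 p.1) else 0 := by
    rw [Fintype.sum_prod_type, ← Finset.sum_fiberwise Finset.univ c]
    unfold crossInfo
    refine Finset.sum_congr rfl fun l _ => ?_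
    rw [Finset.sum_congr rfl fun i _ => (Finset.sum_fiberwise Finset.univ c fun j =>
      if c i < c j then mutualInfo μ (Y i j) (Y j i) else 0).symm]
    rw [Finset.sum_comm (s := Finset.univ.filter fun i => c i = l), Finset.sum_filter]
    refine Finset.sum_congr rfl fun r _ => ?_
    split_ifs with hlr
    · refine Finset.sum_congr rfl fun i hi => Finset.sum_congr rfl fun j hj => ?_
      rw [(Finset.mem_filter.1 hi).2, (Finset.mem_filter.1 hj).2, if_pos hlr]
    · refine (Finset.sum_eq_zero fun i hi => Finset.sum_eq_zero fun j hj => ?_).symm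
      rw [(Finset.mem_filter.1 hi).2, (Finset.mem_filter.1 hj).2, if_neg hlr]
  rw [h1]
  set f : Fin m × Fin m → ℝ := fun p =>
    if c p.1 < c p.2 then mutualInfo μ (Y p.1 p.2) (Y p.2 p.1) else 0 with hf
  have h2 : ∑ p, f p = ∑ p : Fin m × Fin m, (if p.1 < p.2 then f p else 0) +
      ∑ p : Fin m × Fin m, (if p.2 < p.1 then f p else 0) := by
    rw [← Finset.sum_add_distrib]
    refine Finset.sum_congr rfl fun p _ => ?_
    rcases lt_trichotomy p.1 p.2 with h | h | h
    · simp [h, h.le, not_lt]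
    · simp [hf, h]
    · simp [h, h.le, not_lt]
  rw [h2, ← (Equiv.prodComm (Fin m) (Fin m)).sum_comp fun p => if p.2 < p.1 then f p else 0,
    ← Finset.sum_add_distrib]
  have h3 : ∀ p : Fin m × Fin m, ((if p.1 < p.2 then f p else 0) +
      if (Equiv.prodComm _ _ p).2 < (Equiv.prodComm _ _ p).1 then f (Equiv.prodComm _ _ p)
        else 0) = if p.1 < p.2 then (if c p.1 = c p.2 then 0
          else mutualInfo μ (Y p.1 p.2) (Y p.2 p.1)) else 0 := by
    rintro ⟨i, j⟩
    by_cases hij : i < j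
    · rcases lt_trichotomy (c i) (c j) with h | h | h
      · simp [hf, hij, h, h.ne, h.le, not_lt]
      · simp [hf, hij, h]
      · simp [hf, hij, h, h.ne', h.le, not_lt, mutualInfo_comm μ (Y i j)]
    · simp [hij]
  rw [Finset.sum_congr rfl fun p _ => h3 p, ← Finset.sum_filter]
  exact Finset.sum_subtype _ (by simp) _

/-- The restriction to block `l` of the pair of variables attached to a pair of terminals. -/
def blockPair {k : ℕ} (c : Fin m → Fin k) (l : Fin k) (p : Pair m)
    (x : ∀ i, ∀ j : {j : Fin m // j ≠ i}, 𝒴 i j) :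
    Option (𝒴 p.1.1 p.1.2) × Option (𝒴 p.1.2 p.1.1) :=
  (if c p.1.1 = l then some (x p.1.1 ⟨p.1.2, p.2.ne'⟩) else none,
    if c p.1.2 = l then some (x p.1.2 ⟨p.1.1, p.2.ne⟩) else none)

variable [∀ i j, Fintype (𝒴 i j)] [∀ i j, MeasurableSpace (𝒴 i j)]
  [∀ i j, MeasurableSingletonClass (𝒴 i j)]

/-- If both terminals share a block, that block sees the whole pair and the others see constants. If
not, two blocks see one variable each, and H(Y) + H(Y') = H(Y, Y') + I(Y; Y'). -/
theorem sum_entropy_blockPair_le (P : Measure (∀ i, ∀ j : {j : Fin m // j ≠ i}, 𝒴 i j))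
    [IsProbabilityMeasure P] {k : ℕ} (c : Fin m → Fin k) (p : Pair m) :
    ∑ l, entropy P (blockPair c l p) ≤
      entropy P (fun x => (x p.1.1 ⟨p.1.2, p.2.ne'⟩, x p.1.2 ⟨p.1.1, p.2.ne⟩)) +
        if c p.1.1 = c p.1.2 then 0 else
          mutualInfo P (fun x => x p.1.1 ⟨p.1.2, p.2.ne'⟩) (fun x => x p.1.2 ⟨p.1.1, p.2.ne⟩) := by
  obtain ⟨⟨i, j⟩, hij⟩ := p
  dsimp only
  set HQ := entropy P (fun x => (x i ⟨j, hij.ne'⟩, x j ⟨i, hij.ne⟩)) with hHQ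
  set H1 := entropy P (fun x => x i ⟨j, hij.ne'⟩) with hH1
  set H2 := entropy P (fun x => x j ⟨i, hij.ne⟩) with hH2
  have hnone : ∀ l, c i ≠ l → c j ≠ l → entropy P (blockPair c l ⟨(i, j), hij⟩) ≤ 0 := by
    intro l h h'
    rw [← entropy_unit P]
    exact entropy_le_of_determines P fun x x' _ => by simp [blockPair, h, h']
  by_cases h : c i = c j
  · rw [if_pos h, add_zero, ← Finset.add_sum_erase _ _ (Finset.mem_univ (c i))]
    have h1 : entropy P (blockPair c (c i) ⟨(i, j), hij⟩) ≤ HQ :=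
      entropy_le_of_determines P fun x x' e => by
        simp only [Prod.mk.injEq] at e
        simp [blockPair, e.1, e.2]
    have h2 : ∑ l ∈ Finset.univ.erase (c i), entropy P (blockPair c l ⟨(i, j), hij⟩) ≤ 0 :=
      Finset.sum_nonpos fun l hl => hnone l (Finset.ne_of_mem_erase hl).symm
        (h ▸ (Finset.ne_of_mem_erase hl).symm)
    linarith
  · rw [if_neg h]
    have h1 : ∀ l, entropy P (blockPair c l ⟨(i, j), hij⟩) ≤
        (if c i = l then H1 else 0) + if c j = l then H2 else 0 := by
      intro l
      by_cases hi : c i = l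
      · have hj : c j ≠ l := fun hj => h (hi.trans hj.symm)
        rw [if_pos hi, if_neg hj, add_zero]
        exact entropy_le_of_determines P fun x x' e => by simp [blockPair, hj, e]
      · by_cases hj : c j = l
        · rw [if_neg hi, if_pos hj, zero_add]
          exact entropy_le_of_determines P fun x x' e => by simp [blockPair, hi, e]
        · rw [if_neg hi, if_neg hj, add_zero]
          exact hnone l hi hj
    refine (Finset.sum_le_sum fun l _ => h1 l).trans ?_
    simp only [Finset.sum_add_distrib, Finset.sum_ite_eq, Finset.mem_univ, if_true, mutualInfo]
    linarith

/-- For a pair-wise independent network the multi-information of the blocks of a partition is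
at most the total information carried by the pairs across blocks. -/
theorem multiInfo_network_le (μ : Measure Ω) [IsProbabilityMeasure μ] {Y : ∀ i j, Ω → 𝒴 i j}
    (hY : ∀ i j, Measurable (Y i j)) (hind : IsPairwiseIndependent μ Y) {k : ℕ}
    (c : Fin m → Fin k) :
    ∑ l, entropy (networkLaw μ Y) (fun x (i : Block c l) => x i) - entropy (networkLaw μ Y) id ≤
      crossInfo μ Y (fun l => Finset.univ.filter fun i => c i = l) := by
  have hmp := measurePreserving_network μ hY
  have : IsProbabilityMeasure (networkLaw μ Y) := isProbabilityMeasure_networkLaw μ hY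
  set P := networkLaw μ Y with hP
  set Q : ∀ p : Pair m, (∀ i, ∀ j : {j : Fin m // j ≠ i}, 𝒴 i j) →
    𝒴 p.1.1 p.1.2 × 𝒴 p.1.2 p.1.1 :=
    fun p x => (x p.1.1 ⟨p.1.2, p.2.ne'⟩, x p.1.2 ⟨p.1.1, p.2.ne⟩) with hQ
  have hid : ∑ p, entropy P (Q p) ≤ entropy P id := by
    refine sum_entropy_le P Q
      (fun p x (q : {q : Fin m × Fin m // q.1 ≠ q.2 ∧ q ≠ (p.1.1, p.1.2) ∧ q ≠ (p.1.2, p.1.1)}) =>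
        x q.1.1 ⟨q.1.2, q.2.1.symm⟩) ?_ ?_ Finset.univ ?_
    · rintro ⟨⟨i, j⟩, hij⟩ ⟨⟨i', j'⟩, hij'⟩ hne x x' e
      -- Distinct unordered pairs share no variable: equality is excluded here, and the swapped
      -- coincidence by `i < j` and `i' < j'`.
      have hne' : ¬ (i' = i ∧ j' = j) := by
        rintro ⟨rfl, rfl⟩
        exact hne rfl
      have hlt : i < j := hij
      have hlt' : i' < j' := hij'
      refine Prod.ext (congrFun e ⟨(i', j'), hlt'.ne, ?_, ?_⟩)
        (congrFun e ⟨(j', i'), hlt'.ne', ?_, ?_⟩) <;>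
      · simp only [ne_eq, Prod.mk.injEq]
        omega
    · intro p
      rw [← hind p.1.1 p.1.2 p.2.ne]
      unfold mutualInfo
      rw [← entropy_comp_measurePreserving hmp, ← entropy_comp_measurePreserving hmp,
        ← entropy_comp_measurePreserving hmp]
    · rintro x x' e p -
      rw [id, id] at e
      rw [e]
  have hl : ∀ l, entropy P (fun x (i : Block c l) => x i) ≤ ∑ p, entropy P (blockPair c l p) := by
    intro l
    refine entropy_le_sum P (blockPair c l) Finset.univ fun x x' e => ?_
    funext ⟨i, hi⟩ ⟨j, hj⟩
    -- The variable of `i` facing `j` is the first or second component of its pair according to the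
    -- order of `i` and `j`.
    rcases lt_or_gt_of_ne hj with h | h
    · have := congrArg Prod.snd (e ⟨(j, i), h⟩ (Finset.mem_univ _))
      simpa [blockPair, hi] using this
    · have := congrArg Prod.fst (e ⟨(i, j), h⟩ (Finset.mem_univ _))
      simpa [blockPair, hi] using this
  have hI : ∀ p : Pair m, mutualInfo μ (Y p.1.1 p.1.2) (Y p.1.2 p.1.1) =
      mutualInfo P (fun x => x p.1.1 ⟨p.1.2, p.2.ne'⟩) (fun x => x p.1.2 ⟨p.1.1, p.2.ne⟩) := by
    intro p
    unfold mutualInfo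
    rw [← entropy_comp_measurePreserving hmp, ← entropy_comp_measurePreserving hmp,
      ← entropy_comp_measurePreserving hmp]
  rw [crossInfo_eq]
  simp only [hI]
  have h1 := Finset.sum_le_sum fun l (_ : l ∈ Finset.univ) => hl l
  rw [Finset.sum_comm] at h1
  have h2 := Finset.sum_le_sum fun p (_ : p ∈ Finset.univ) => sum_entropy_blockPair_le P c p
  rw [Finset.sum_add_distrib] at h2
  linarith

end Network

/-! ### Partitions as labellings of the terminals -/

section Partitions

variable {m : ℕ} {A : Finset (Fin m)} {k : ℕ}

theorem IsKPartition.exists_eq_fibers {B : Fin k → Finset (Fin m)} (hB : IsKPartition A B) :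
    ∃ c : Fin m → Fin k, (∀ l, ∃ i ∈ A, c i = l) ∧
      B = fun l => Finset.univ.filter fun i => c i = l := by
  choose c hc using hB.cover
  have hiff : ∀ i l, i ∈ B l ↔ c i = l := fun i l =>
    ⟨fun h => by_contra fun hne => Finset.disjoint_left.1 (hB.disjoint _ _ hne) (hc i) h,
      fun h => h ▸ hc i⟩
  refine ⟨c, fun l => ?_, ?_⟩
  · obtain ⟨i, hi⟩ := hB.meets l
    rw [Finset.mem_inter] at hi
    exact ⟨i, hi.2, (hiff i l).1 hi.1⟩
  · ext l i
    simp [hiff]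

/-- Needed because the infimum of an empty set of reals is 0 by convention. Embed k labels into A
and label terminals by the inverse; those outside the image all receive one arbitrary label. -/
theorem exists_isKPartition (hk : 1 ≤ k) (hkA : k ≤ A.card) :
    ∃ B : Fin k → Finset (Fin m), IsKPartition A B := by
  have : Nonempty (Fin k) := ⟨⟨0, hk⟩⟩
  have hcard : Fintype.card (Fin k) ≤ Fintype.card A := by simpa using hkA
  obtain ⟨e⟩ := Function.Embedding.nonempty_of_card_le hcard
  have hinj : Function.Injective fun l => (e l : Fin m) := Subtype.val_injective.comp e.injective
  refine ⟨fun l => Finset.univ.filter fun i => Function.invFun (fun l => (e l : Fin m)) i = l,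
    ?_, ?_, ?_⟩
  · intro l r hlr
    refine Finset.disjoint_left.2 fun i hi hi' => hlr ?_
    exact (Finset.mem_filter.1 hi).2.symm.trans (Finset.mem_filter.1 hi').2
  · exact fun i => ⟨_, Finset.mem_filter.2 ⟨Finset.mem_univ i, rfl⟩⟩
  · intro l
    refine ⟨e l, Finset.mem_inter.2 ⟨Finset.mem_filter.2 ⟨Finset.mem_univ _, ?_⟩, (e l).2⟩⟩
    exact Function.leftInverse_invFun hinj l

end Partitions

end SecretKey

end

/-! ### The partition bound on the capacity -/

theorem lemma1 {m : ℕ} {Ω : Type*} [MeasurableSpace Ω] (μ : Measure Ω) [IsProbabilityMeasure μ]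
    {𝒴 : Fin m → Fin m → Type*} [∀ i j, Fintype (𝒴 i j)] [∀ i j, MeasurableSpace (𝒴 i j)]
    [∀ i j, MeasurableSingletonClass (𝒴 i j)]
    (Y : ∀ i j, Ω → 𝒴 i j) (hY : ∀ i j, Measurable (Y i j))
    (hind : SecretKey.IsPairwiseIndependent μ Y)
    (A : Finset (Fin m)) (hA : 2 ≤ A.card) :
    SecretKey.capacity (SecretKey.networkLaw μ Y) A ≤
      ((SecretKey.partitionBound μ Y A : ℝ) : EReal) := by
  have : IsProbabilityMeasure (SecretKey.networkLaw μ Y) :=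
    SecretKey.isProbabilityMeasure_networkLaw μ hY
  -- A lower bound for each member bounds a real infimum only if the set is nonempty; k = 2 is the
  -- witness, as |A| ≥ 2.
  refine iSup₂_le fun R hR => EReal.coe_le_coe_iff.2 (le_csInf ⟨_, 2, le_rfl, hA, rfl⟩ ?_)
  rintro v ⟨k, hk, hkA, rfl⟩
  have hk' : (2 : ℝ) ≤ k := by exact_mod_cast hk
  rw [le_div_iff₀ (by linarith)]
  obtain ⟨B₀, hB₀⟩ := SecretKey.exists_isKPartition (A := A) (by omega : 1 ≤ k) hkA
  refine le_csInf ⟨_, B₀, hB₀, rfl⟩ ?_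
  rintro v ⟨B, hB, rfl⟩
  obtain ⟨c, hc, rfl⟩ := hB.exists_eq_fibers
  exact (hR.mul_le hk c hc).trans (SecretKey.multiInfo_network_le μ hY hind c)
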